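/- **Theorem.** The categories $\mathbf{SkeLC}$ and $\mathbf{DSkeLC}$ defined below are dually equivalent, by means of the contravariant functors described below. *Definitions.* $\mathbf{SkeLC}$ has as objects the locally compact Hausdorff spaces and as morphisms the continuous maps $f:X\to Y$ that are *skeletal*, i.e. $\operatorname{int}(f^{-1}(\operatorname{cl}V))\subseteq\operatorname{cl}(f^{-1}(V))$ for every open $V\subseteq Y$. A *contact relation* on a Boolean algebra $B$ (where $0=1$ is allowed) is a binary relation $\rho$ such that: $a\neq0$ implies $a\rho a$; $a\rho b$ implies $a\ne 0$ and $b\neq 0$; $a\rho b$ implies $b\rho a$; $a\rho(b\vee c)$ iff $a\rho b$ or $a\rho c$. Write $a\ll b$ if not $a\rho b^*$, where $b^*$ is the complement of $b$. A *complete local contact algebra* $(B,\rho,\mathbb B)$ is a complete Boolean algebra $B$ with a contact relation $\rho$ and a (possibly non-proper) ideal $\mathbb B$ of *bounded* elements such that: (BC1) if $a\in\mathbb B$ and $a\ll c$, then $a\ll b\ll c$ for some $b\in\mathbb B$; (BC2) if $a\rho b$, then $a\rho(c\wedge b)$ for some $c\in\mathbb B$; (BC3) if $a\ne0$, then $b\ll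 a$ for some $b\in\mathbb B\setminus\{0\}$. $\mathbf{DSkeLC}$ has as objects the complete local contact algebras and as morphisms $\varphi:(A,\rho,\mathbb B)\to(B,\eta,\mathbb B')$ the Boolean homomorphisms preserving all joins and meets such that (L1) $\varphi(a)\,\eta\,\varphi(b)$ implies $a\rho b$ for all $a,b\in A$, and (L2) $b\in\mathbb B'$ implies $\varphi_\Lambda(b)\in\mathbb B$, where $\varphi_\Lambda(b)=\bigwedge\{a\in A\mid b\le\varphi(a)\}$ is the left adjoint of $\varphi$. For $(B,\rho,\mathbb B)$ let $a\,C_\rho\,b$ mean that $a\rho b$ or $a,b\notin\mathbb B$. A *bounded cluster* is a set $\sigma\subseteq B$ with $\sigma\cap\mathbb B\ne\emptyset$ such that: $a\,C_\rho\,b$ for all $a,b\in\sigma$; $a\vee b\in\sigma$ implies $a\in\sigma$ or $b\in\sigma$; if $a\,C_\rho\,b$ for every $b\in\sigma$, then $a\in\sigma$. For an ultrafilter $u$ of $B$ put $\sigma_u=\{a\mid a\,C_\rho\,b\text{ for every }b\in u\}$. *The functors.* 1. $\Psi^t:\mathbf{SkeLC}\to\mathbf{DSkeLC}$ sends $X$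 to $(RC(X),\rho_X,CR(X))$, where $RC(X)$ is the complete Boolean algebra of regular closed sets ordered by inclusion, $F\rho_XG$ iff $F\cap G\neq\emptyset$, and $CR(X)$ is the ideal of compact regular closed sets; it sends $f:X\to Y$ to $F\mapsto\operatorname{cl}(f^{-1}(\operatorname{int}F))$. 2. $\Psi^a:\mathbf{DSkeLC}\to\mathbf{SkeLC}$ sends $(B,\rho,\mathbb B)$ to the set of its bounded clusters with the topology for which the sets $\{\sigma\mid a\in\sigma\}$, $a\in B$, form a closed base; it sends $\varphi:A\to B$ to the map taking each bounded cluster of $B$ of the form $\sigma_u$, with $u$ an ultrafilter of $B$, to $\sigma_{\varphi^{-1}(u)}$. The natural isomorphisms of the dual equivalence are $X\to\Psi^a\Psi^tX$, $x\mapsto\{F\in RC(X)\mid x\in F\}$, and $A\to\Psi^t\Psi^aA$, $a\mapsto\{\sigma\mid a\in\sigma\}$. -/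

import Mathlib

open CategoryTheory Opposite

universe u

namespace SkeletalDuality

/-! ### Contact algebras and local contact algebras -/

section Contact

variable {B : Type u} [BooleanAlgebra B]

/-- The relation `C` is a contact relation on the Boolean algebra `B`, i.e. `(B, C)` is a
contact algebra. -/
structure IsContact (C : B → B → Prop) : Prop where
  refl_of_ne_bot : ∀ a : B, a ≠ ⊥ → C a a
  ne_bot : ∀ a b : B, C a b → a ≠ ⊥ ∧ b ≠ ⊥
  symm : ∀ a b : B, C a b → C b a
  sup_right : ∀ a b c : B, C a (b ⊔ c) ↔ C a b ∨ C a c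

/-- Non-tangential inclusion `a ≪ b` with respect to a relation `C`. -/
def NonTangential (C : B → B → Prop) (a b : B) : Prop :=
  ¬ C a bᶜ

/-- `(B, ρ, I)` is a local contact algebra; the elements of the (possibly improper) ideal `I`
are the bounded elements. -/
structure IsLocalContact (ρ : B → B → Prop) (I : Order.Ideal B) : Prop where
  isContact : IsContact ρ
  exists_between : ∀ a ∈ I, ∀ c : B, NonTangential ρ a c →
    ∃ b ∈ I, NonTangential ρ a b ∧ NonTangential ρ b c
  exists_bounded : ∀ a b : B, ρ a b → ∃ c ∈ I, ρ a (c ⊓ b)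
  exists_nonTangential : ∀ a : B, a ≠ ⊥ → ∃ b ∈ I, b ≠ ⊥ ∧ NonTangential ρ b a

/-- The Alexandroff extension `C_ρ` of `ρ`: `a C_ρ b` iff `a ρ b` or both are unbounded. -/
def alexandroffExt (ρ : B → B → Prop) (I : Order.Ideal B) (a b : B) : Prop :=
  ρ a b ∨ (a ∉ I ∧ b ∉ I)

/-- Clusters in `(B, C)`. -/
structure IsCluster (C : B → B → Prop) (σ : Set B) : Prop where
  nonempty : σ.Nonempty
  contact : ∀ a ∈ σ, ∀ b ∈ σ, C a b
  mem_or_mem : ∀ a b : B, a ⊔ b ∈ σ → a ∈ σ ∨ b ∈ σ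
  mem_of_contact : ∀ a : B, (∀ b ∈ σ, C a b) → a ∈ σ

/-- Ultrafilters of the Boolean algebra `B`. -/
structure IsBoolUltrafilter (v : Set B) : Prop where
  top_mem : ⊤ ∈ v
  bot_notMem : ⊥ ∉ v
  mem_of_le : ∀ a b : B, a ∈ v → a ≤ b → b ∈ v
  inf_mem : ∀ a b : B, a ∈ v → b ∈ v → a ⊓ b ∈ v
  mem_or_compl_mem : ∀ a : B, a ∈ v ∨ aᶜ ∈ v

/-- The set `σ_v` of all elements that are in contact with every element of `v`. -/
def clusterOf (C : B → B → Prop) (v : Set B) : Set B :=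
  {a | ∀ b ∈ v, C a b}

end Contact

/-! ### The left adjoint of a complete Boolean homomorphism -/

section LeftAdjoint

variable {A B D : Type u} [CompleteBooleanAlgebra A] [CompleteBooleanAlgebra B]
  [CompleteBooleanAlgebra D]

/-- The left (lower) adjoint `φ_Λ` of `φ`. -/
def leftAdj (φ : CompleteLatticeHom A B) (b : B) : A :=
  sInf {a : A | b ≤ φ a}

theorem gc_leftAdj (φ : CompleteLatticeHom A B) : GaloisConnection (leftAdj φ) φ := by
  intro b a
  constructor
  · intro h
    have h1 : b ≤ φ (leftAdj φ b) := by
      rw [leftAdj, map_sInf]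
      refine le_sInf ?_
      rintro _ ⟨x, hx, rfl⟩
      exact hx
    exact h1.trans (OrderHomClass.mono φ h)
  · intro h
    exact sInf_le h

theorem leftAdj_id (b : B) : leftAdj (CompleteLatticeHom.id B) b = b :=
  (gc_leftAdj (CompleteLatticeHom.id B)).l_unique GaloisConnection.id (fun _ => rfl)

theorem leftAdj_comp (ψ : CompleteLatticeHom B D) (φ : CompleteLatticeHom A B) (d : D) :
    leftAdj (ψ.comp φ) d = leftAdj φ (leftAdj ψ d) :=
  (gc_leftAdj (ψ.comp φ)).l_unique ((gc_leftAdj ψ).compose (gc_leftAdj φ)) (fun _ => rfl)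

end LeftAdjoint

/-! ### The category `DSkeLC` -/

/-- A complete local contact algebra. -/
structure DSkeLC : Type (u + 1) where
  carrier : Type u
  [str : CompleteBooleanAlgebra carrier]
  /-- the contact relation -/
  contact : carrier → carrier → Prop
  /-- the ideal of bounded elements -/
  bounded : Order.Ideal carrier
  isLocalContact : IsLocalContact contact bounded

attribute [instance] DSkeLC.str

namespace DSkeLC

/-- Complete Boolean homomorphisms (a homomorphism of complete lattices between Boolean
algebras preserves complements) satisfying (L1) and (L2). -/
structure Mor (A B : DSkeLC.{u}) : Type u where
  hom : CompleteLatticeHom A.carrier B.carrier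
  contact_of_contact : ∀ a b : A.carrier, B.contact (hom a) (hom b) → A.contact a b
  leftAdj_bounded : ∀ b ∈ B.bounded, leftAdj hom b ∈ A.bounded

theorem Mor.ext' {A B : DSkeLC.{u}} {φ ψ : Mor A B} (h : φ.hom = ψ.hom) : φ = ψ := by
  cases φ; cases ψ; cases h; rfl

instance : Category.{u} DSkeLC.{u} where
  Hom A B := Mor A B
  id A :=
    { hom := CompleteLatticeHom.id A.carrier
      contact_of_contact := fun _ _ h => h
      leftAdj_bounded := fun b hb => by rw [leftAdj_id]; exact hb }
  comp {A B D} φ ψ :=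
    { hom := ψ.hom.comp φ.hom
      contact_of_contact := fun a b h =>
        φ.contact_of_contact a b (ψ.contact_of_contact _ _ h)
      leftAdj_bounded := fun d hd => by
        rw [leftAdj_comp]
        exact φ.leftAdj_bounded _ (ψ.leftAdj_bounded _ hd) }
  id_comp _ := Mor.ext' rfl
  comp_id _ := Mor.ext' rfl
  assoc _ _ _ := Mor.ext' rfl

end DSkeLC

/-! ### The category `SkeLC` -/

/-- Skeletal functions. -/
def IsSkeletal {X Y : Type u} [TopologicalSpace X] [TopologicalSpace Y] (f : X → Y) : Prop :=
  ∀ V : Set Y, IsOpen V → interior (f ⁻¹' closure V) ⊆ closure (f ⁻¹' V)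

theorem isSkeletal_iff {X Y : Type u} [TopologicalSpace X] [TopologicalSpace Y] {f : X → Y} :
    IsSkeletal f ↔
      ∀ U : Set X, IsOpen U → U.Nonempty → (interior (closure (f '' U))).Nonempty := by
  constructor
  · intro h U hU hne
    by_contra hemp
    rw [Set.not_nonempty_iff_eq_empty] at hemp
    obtain ⟨x, hx⟩ := hne
    have hcl : closure ((closure (f '' U))ᶜ) = Set.univ := by
      rw [closure_compl, hemp, Set.compl_empty]
    have h1 := h (closure (f '' U))ᶜ isClosed_closure.isOpen_compl
    rw [hcl, Set.preimage_univ, interior_univ] at h1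
    obtain ⟨y, hyU, hy⟩ := mem_closure_iff.1 (h1 (Set.mem_univ x)) U hU hx
    exact hy (subset_closure ⟨y, hyU, rfl⟩)
  · intro h V hV x hx
    rw [mem_closure_iff]
    intro O hO hxO
    by_contra hemp
    rw [Set.not_nonempty_iff_eq_empty] at hemp
    obtain ⟨y, hy⟩ := h (O ∩ interior (f ⁻¹' closure V)) (hO.inter isOpen_interior) ⟨x, hxO, hx⟩
    have hsub : closure (f '' (O ∩ interior (f ⁻¹' closure V))) ⊆ closure V \ V := by
      refine closure_minimal ?_ (isClosed_closure.sdiff hV)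
      rintro _ ⟨z, ⟨hzO, hz⟩, rfl⟩
      refine ⟨(interior_subset hz : z ∈ f ⁻¹' closure V), fun hzV => ?_⟩
      have hz2 : z ∈ O ∩ f ⁻¹' V := ⟨hzO, hzV⟩
      rw [hemp] at hz2
      exact hz2
    have hyV := (hsub (interior_subset hy)).1
    obtain ⟨w, hw, hwV⟩ := mem_closure_iff.1 hyV _ isOpen_interior hy
    exact (hsub (interior_subset hw)).2 hwV

theorem IsSkeletal.id {X : Type u} [TopologicalSpace X] : IsSkeletal (fun x : X => x) :=
  fun _ _ => interior_subset

theorem IsSkeletal.comp {X Y Z : Type u} [TopologicalSpace X] [TopologicalSpace Y]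
    [TopologicalSpace Z] {g : Y → Z} {f : X → Y} (hg : IsSkeletal g) (hgc : Continuous g)
    (hf : IsSkeletal f) : IsSkeletal (g ∘ f) := by
  rw [isSkeletal_iff] at *
  intro U hU hne
  refine (hg _ isOpen_interior (hf U hU hne)).mono (interior_mono ?_)
  refine closure_minimal ?_ isClosed_closure
  rw [Set.image_comp]
  exact (Set.image_mono interior_subset).trans (image_closure_subset_closure_image hgc)

/-- A locally compact Hausdorff space. -/
structure SkeLC : Type (u + 1) where
  carrier : Type u
  [top : TopologicalSpace carrier]
  [t2 : T2Space carrier]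
  [lc : LocallyCompactSpace carrier]

attribute [instance] SkeLC.top SkeLC.t2 SkeLC.lc

namespace SkeLC

/-- Continuous skeletal maps. -/
structure Mor (X Y : SkeLC.{u}) : Type u where
  fn : X.carrier → Y.carrier
  continuous_fn : Continuous fn
  skeletal_fn : IsSkeletal fn

instance : Category.{u} SkeLC.{u} where
  Hom X Y := Mor X Y
  id X := ⟨fun x => x, continuous_id, IsSkeletal.id⟩
  comp f g :=
    ⟨g.fn ∘ f.fn, g.continuous_fn.comp f.continuous_fn,
      g.skeletal_fn.comp g.continuous_fn f.skeletal_fn⟩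

end SkeLC

/-! ### Regular closed sets -/

/-- The regular closed subsets of `X`. -/
def RC (X : Type u) [TopologicalSpace X] : Type u :=
  {F : Set X // closure (interior F) = F}

namespace RC

variable {X : Type u} [TopologicalSpace X]

/-- The regular closed set `cl (int S)`. -/
def reg (S : Set X) : RC X :=
  ⟨closure (interior S),
    subset_antisymm (closure_minimal interior_subset isClosed_closure)
      (closure_mono (interior_maximal subset_closure isOpen_interior))⟩

theorem closure_isOpen_regular {U : Set X} (hU : IsOpen U) :
    closure (interior (closure U)) = closure U :=
  subset_antisymm (closure_minimal interior_subset isClosed_closure)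
    (closure_mono (interior_maximal subset_closure hU))

theorem isClosed (F : RC X) : IsClosed F.1 := by
  rw [← F.2]; exact isClosed_closure

theorem closure_iUnion_regular (S : Set (RC X)) :
    closure (interior (closure (⋃ F ∈ S, F.1))) = closure (⋃ F ∈ S, F.1) := by
  refine subset_antisymm (closure_minimal interior_subset isClosed_closure)
    (closure_minimal ?_ isClosed_closure)
  refine Set.iUnion₂_subset fun F hF => ?_
  calc F.1 = closure (interior F.1) := F.2.symm
    _ ⊆ _ := closure_mono (interior_mono ((Set.subset_biUnion_of_mem hF).trans subset_closure))

theorem union_regular (F G : RC X) : closure (interior (F.1 ∪ G.1)) = F.1 ∪ G.1 := by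
  refine subset_antisymm (closure_minimal interior_subset (F.isClosed.union G.isClosed)) ?_
  refine Set.union_subset ?_ ?_
  · exact F.2.symm.subset.trans (closure_mono (interior_mono Set.subset_union_left))
  · exact G.2.symm.subset.trans (closure_mono (interior_mono Set.subset_union_right))

theorem reg_subset {S : Set X} (hS : IsClosed S) : (reg S).1 ⊆ S :=
  closure_minimal interior_subset hS

theorem subset_reg {F : RC X} {S : Set X} (h : F.1 ⊆ S) : F.1 ⊆ (reg S).1 := by
  calc F.1 = closure (interior F.1) := F.2.symm
    _ ⊆ _ := closure_mono (interior_mono h)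

/-- The complete Boolean algebra of regular closed sets, ordered by inclusion: `0 = ∅`, `1 = X`,
`F ∨ G = F ∪ G`, `F ∧ G = cl (int (F ∩ G))`, `F* = cl (X \ F)`, arbitrary joins are closures of
unions, arbitrary meets are of the form `cl (int (⋂ F))`. -/
instance : CompleteBooleanAlgebra (RC X) where
  le F G := F.1 ⊆ G.1
  le_refl F := subset_refl F.1
  le_trans _ _ _ h h' := Set.Subset.trans h h'
  le_antisymm _ _ h h' := Subtype.ext (subset_antisymm h h')
  sup F G := ⟨F.1 ∪ G.1, union_regular F G⟩
  le_sup_left _ _ := Set.subset_union_left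
  le_sup_right _ _ := Set.subset_union_right
  sup_le _ _ _ h h' := Set.union_subset h h'
  inf F G := reg (F.1 ∩ G.1)
  inf_le_left F G := (reg_subset (F.isClosed.inter G.isClosed)).trans Set.inter_subset_left
  inf_le_right F G := (reg_subset (F.isClosed.inter G.isClosed)).trans Set.inter_subset_right
  le_inf _ _ _ h h' := subset_reg (Set.subset_inter h h')
  le_sup_inf F G H := by
    change closure (interior ((F.1 ∪ G.1) ∩ (F.1 ∪ H.1))) ⊆ F.1 ∪ closure (interior (G.1 ∩ H.1))
    refine closure_minimal ?_ (F.isClosed.union isClosed_closure)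
    rw [← Set.union_inter_distrib_left]
    intro x hx
    by_cases hxF : x ∈ F.1
    · exact Or.inl hxF
    · refine Or.inr (subset_closure ?_)
      refine mem_interior.2 ⟨interior (F.1 ∪ G.1 ∩ H.1) \ F.1, ?_,
        isOpen_interior.sdiff F.isClosed, hx, hxF⟩
      rintro y ⟨hy, hyF⟩
      exact (interior_subset hy).resolve_left hyF
  top := ⟨Set.univ, by simp⟩
  bot := ⟨∅, by simp⟩
  le_top _ := Set.subset_univ _
  bot_le _ := Set.empty_subset _
  compl F := ⟨closure F.1ᶜ, closure_isOpen_regular F.isClosed.isOpen_compl⟩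
  inf_compl_le_bot F := by
    change closure (interior (F.1 ∩ closure F.1ᶜ)) ⊆ ∅
    rw [closure_compl, interior_inter]
    refine closure_minimal ?_ isClosed_empty
    rintro x ⟨hx, hx'⟩
    exact (interior_subset hx' hx).elim
  top_le_sup_compl F := by
    change Set.univ ⊆ F.1 ∪ closure F.1ᶜ
    intro x _
    by_cases hx : x ∈ F.1
    · exact Or.inl hx
    · exact Or.inr (subset_closure hx)
  sSup S := ⟨closure (⋃ F ∈ S, F.1), closure_iUnion_regular S⟩
  isLUB_sSup S := by
    refine ⟨fun F hF => ?_, fun G hG => ?_⟩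
    · exact (Set.subset_biUnion_of_mem (u := fun F : RC X => F.1) hF).trans subset_closure
    · exact closure_minimal (Set.iUnion₂_subset fun F hF => hG hF) G.isClosed
  sInf S := reg (⋂ F ∈ S, F.1)
  isGLB_sInf S := by
    refine ⟨fun F hF => ?_, fun G hG => ?_⟩
    · exact (reg_subset (isClosed_biInter fun H _ => H.isClosed)).trans
        (Set.biInter_subset_of_mem hF)
    · exact subset_reg (Set.subset_iInter₂ fun F hF => hG hF)

end RC

/-! ### The space of bounded clusters -/

/-- The set of all clusters in `(A, C_ρ)`. -/
def Clust (A : DSkeLC.{u}) : Type u :=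
  {σ : Set A.carrier // IsCluster (alexandroffExt A.contact A.bounded) σ}

/-- The topology on the clusters for which the sets `{σ | a ∈ σ}` are a closed base. (They are
closed under finite unions by the cluster axioms, so it suffices to generate the topology by
their complements.) -/
instance (A : DSkeLC.{u}) : TopologicalSpace (Clust A) :=
  TopologicalSpace.generateFrom {U | ∃ a : A.carrier, U = {σ : Clust A | a ∈ σ.1}ᶜ}

/-- The space of bounded clusters, with the subspace topology. -/
def BClust (A : DSkeLC.{u}) : Type u :=
  {σ : Clust A // ∃ a ∈ σ.1, a ∈ A.bounded}

instance (A : DSkeLC.{u}) : TopologicalSpace (BClust A) :=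
  inferInstanceAs (TopologicalSpace {σ : Clust A // ∃ a ∈ σ.1, a ∈ A.bounded})

/-- A bounded cluster, as a subset of the algebra. -/
def BClust.toSet {A : DSkeLC.{u}} (σ : BClust A) : Set A.carrier :=
  σ.1.1

end SkeletalDuality

open SkeletalDuality

/-! The functor of regular closed sets is fully faithful, and every complete local contact algebra
`A` is isomorphic to the regular closed algebra of its bounded cluster space; hence it is an
equivalence. The cluster functor is the resulting inverse, so no choice of ultrafilter enters its
definition. Its formula on morphisms and the unit are computed afterwards.

Essential surjectivity. By the prime ideal theorem there are enough bounded clusters `σ_v`. They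
show that `a ↦ {σ | a ∈ σ}` is an order isomorphism onto the regular closed sets
(`basicSet_subset_iff`, `exists_basicSet_eq`), that it turns contact into intersection
(`basicSet_inter_nonempty_iff`) and boundedness into compactness (`isCompact_basicSet_iff`).

Fullness. Given `φ : RC Y → RC X`, send `x` to a point of `Y` lying in every `G` with `x ∈ int
φ(G)`. Such a point exists because (L2) makes `φ_Λ(K)` compact for a compact neighbourhood `K` of
`x`. Then (L1) gives continuity, and preservation of joins gives skeletality and `φ(G) = cl f⁻¹(int
G)`. Faithfulness holds because compact regular closed neighbourhoods separate points. -/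

namespace SkeletalDuality

/-! ### Regular closed sets of a locally compact Hausdorff space -/

namespace RC

variable {X Y : Type u} [TopologicalSpace X] [TopologicalSpace Y]

theorem le_iff {F G : RC X} : F ≤ G ↔ F.1 ⊆ G.1 := Iff.rfl

theorem coe_sup (F G : RC X) : (F ⊔ G).1 = F.1 ∪ G.1 := rfl

theorem coe_inf (F G : RC X) : (F ⊓ G).1 = closure (interior (F.1 ∩ G.1)) := rfl

theorem coe_compl (F : RC X) : (Fᶜ).1 = closure F.1ᶜ := rfl

theorem coe_bot : (⊥ : RC X).1 = ∅ := rfl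

theorem coe_top : (⊤ : RC X).1 = Set.univ := rfl

theorem coe_compl_eq (F : RC X) : (Fᶜ).1 = (interior F.1)ᶜ := by
  rw [coe_compl, closure_compl]

theorem mem_interior_iff {F : RC X} {x : X} : x ∈ interior F.1 ↔ x ∉ (Fᶜ).1 := by
  rw [coe_compl_eq, Set.mem_compl_iff, not_not]

theorem interior_coe_inf (F G : RC X) :
    interior F.1 ∩ interior G.1 ⊆ interior (F ⊓ G).1 := by
  rw [coe_inf, ← interior_inter]
  exact interior_maximal subset_closure isOpen_interior

theorem interior_nonempty {F : RC X} (hF : F.1.Nonempty) : (interior F.1).Nonempty := by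
  rw [← closure_nonempty_iff, F.2]
  exact hF

theorem ne_bot_iff {F : RC X} : F ≠ ⊥ ↔ F.1.Nonempty := by
  rw [Set.nonempty_iff_ne_empty]
  exact not_congr ⟨fun h => h ▸ rfl, fun h => Subtype.ext h⟩

/-- The regular closed closure of an open set. -/
def ofOpen (U : Set X) (hU : IsOpen U) : RC X :=
  ⟨closure U, closure_isOpen_regular hU⟩

theorem ofOpen_interior (F : RC X) : ofOpen (interior F.1) isOpen_interior = F :=
  Subtype.ext F.2

theorem compl_eq_ofOpen (F : RC X) : Fᶜ = ofOpen F.1ᶜ F.isClosed.isOpen_compl := rfl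

theorem sSup_eq_ofOpen (S : Set (RC X)) :
    sSup S = ofOpen (⋃ F ∈ S, interior F.1) (isOpen_biUnion fun _ _ => isOpen_interior) := by
  refine Subtype.ext (subset_antisymm (closure_minimal ?_ isClosed_closure)
    (closure_mono (Set.iUnion₂_mono fun F _ => interior_subset)))
  refine Set.iUnion₂_subset fun F hF => ?_
  rw [← F.2]
  exact closure_mono (Set.subset_biUnion_of_mem (u := fun F : RC X => interior F.1) hF)

theorem exists_isCompact_between [T2Space X] [LocallyCompactSpace X] {K U : Set X}
    (hK : IsCompact K) (hU : IsOpen U) (hKU : K ⊆ U) :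
    ∃ F : RC X, IsCompact F.1 ∧ K ⊆ interior F.1 ∧ F.1 ⊆ U := by
  obtain ⟨L, hL, hKL, hLU⟩ := exists_compact_between hK hU hKU
  have hsub : (reg L).1 ⊆ L := reg_subset hL.isClosed
  exact ⟨reg L, hL.of_isClosed_subset (reg L).isClosed hsub,
    hKL.trans (interior_maximal subset_closure isOpen_interior), hsub.trans hLU⟩

theorem exists_isCompact_mem [T2Space X] [LocallyCompactSpace X] {x : X} {U : Set X}
    (hU : IsOpen U) (hx : x ∈ U) :
    ∃ F : RC X, IsCompact F.1 ∧ x ∈ interior F.1 ∧ F.1 ⊆ U := by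
  obtain ⟨F, hF, hxF, hFU⟩ := exists_isCompact_between isCompact_singleton hU
    (Set.singleton_subset_iff.2 hx)
  exact ⟨F, hF, Set.singleton_subset_iff.1 hxF, hFU⟩

/-- The standard contact relation on the regular closed sets. -/
def Contact (F G : RC X) : Prop :=
  (F.1 ∩ G.1).Nonempty

theorem nonTangential_iff {F G : RC X} : NonTangential Contact F G ↔ F.1 ⊆ interior G.1 := by
  rw [NonTangential, Contact, Set.not_nonempty_iff_eq_empty, coe_compl_eq,
    ← Set.sdiff_eq, Set.sdiff_eq_empty]

theorem isContact : IsContact (Contact (X := X)) where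
  refl_of_ne_bot F hF := by
    rw [Contact, Set.inter_self]
    exact ne_bot_iff.1 hF
  ne_bot F G h := ⟨ne_bot_iff.2 (h.mono Set.inter_subset_left),
    ne_bot_iff.2 (h.mono Set.inter_subset_right)⟩
  symm F G h := by
    rw [Contact, Set.inter_comm]
    exact h
  sup_right F G H := by
    simp only [Contact, coe_sup, Set.inter_union_distrib_left, Set.union_nonempty]

/-- The ideal of compact regular closed sets. -/
def compactIdeal (X : Type u) [TopologicalSpace X] : Order.Ideal (RC X) where
  carrier := {F | IsCompact F.1}
  lower' _ G hGF hF := IsCompact.of_isClosed_subset hF G.isClosed hGF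
  nonempty' := ⟨⊥, isCompact_empty⟩
  directed' F hF G hG := ⟨F ⊔ G, IsCompact.union hF hG, le_sup_left, le_sup_right⟩

theorem isLocalContact [T2Space X] [LocallyCompactSpace X] :
    IsLocalContact (Contact (X := X)) (compactIdeal X) where
  isContact := isContact
  exists_between _ hF _ hFG := by
    obtain ⟨H, hH, hFH, hHG⟩ :=
      exists_isCompact_between hF isOpen_interior (nonTangential_iff.1 hFG)
    exact ⟨H, hH, nonTangential_iff.2 hFH, nonTangential_iff.2 hHG⟩
  exists_bounded _ G := by
    rintro ⟨x, hxF, hxG⟩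
    obtain ⟨H, hH, hxH, -⟩ := exists_isCompact_mem isOpen_univ (Set.mem_univ x)
    refine ⟨H, hH, x, hxF, ?_⟩
    -- An open set that meets `cl (int G)` at `x` has `x` in the closure of its intersection with
    -- `int G`.
    rw [coe_inf, interior_inter]
    rw [← G.2] at hxG
    exact isOpen_interior.inter_closure ⟨hxH, hxG⟩
  exists_nonTangential F hF := by
    obtain ⟨x, hx⟩ := interior_nonempty (ne_bot_iff.1 hF)
    obtain ⟨H, hH, hxH, hHF⟩ := exists_isCompact_mem isOpen_interior hx
    exact ⟨H, hH, ne_bot_iff.2 ⟨x, interior_subset hxH⟩, nonTangential_iff.2 hHF⟩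

/-- The regular closed set `cl (f⁻¹ (int F))`. -/
def comap (f : X → Y) (hf : Continuous f) (F : RC Y) : RC X :=
  ofOpen (f ⁻¹' interior F.1) (isOpen_interior.preimage hf)

/-! ### Pulling regular closed sets back along a skeletal map -/

section Comap

variable {f : X → Y} (hf : Continuous f)

theorem comap_subset (F : RC Y) : (comap f hf F).1 ⊆ f ⁻¹' F.1 :=
  closure_minimal (Set.preimage_mono interior_subset) (F.isClosed.preimage hf)

/-- One inclusion is continuity, the other is skeletality. -/
theorem closure_preimage_eq (hf : Continuous f) (hs : IsSkeletal f) {V : Set Y} (hV : IsOpen V) :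
    closure (f ⁻¹' V) = closure (interior (f ⁻¹' closure V)) :=
  subset_antisymm
    (closure_mono (interior_maximal (Set.preimage_mono subset_closure) (hV.preimage hf)))
    (closure_minimal (hs V hV) isClosed_closure)

/-- A regular closed set may be represented by any open set with that closure, not only by its
interior. Complements, joins and functoriality all reduce to this. -/
theorem comap_ofOpen (hs : IsSkeletal f) {V : Set Y} (hV : IsOpen V) :
    comap f hf (ofOpen V hV) = ofOpen (f ⁻¹' V) (hV.preimage hf) := by
  refine Subtype.ext (subset_antisymm ?_
    (closure_mono (Set.preimage_mono (interior_maximal subset_closure hV))))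
  refine Set.Subset.trans (closure_mono ?_) (closure_preimage_eq hf hs hV).symm.subset
  exact interior_maximal (Set.preimage_mono interior_subset) (isOpen_interior.preimage hf)

theorem comap_compl (hs : IsSkeletal f) (F : RC Y) : comap f hf Fᶜ = (comap f hf F)ᶜ := by
  rw [compl_eq_ofOpen, comap_ofOpen hf hs]
  refine Subtype.ext ?_
  change closure (f ⁻¹' F.1ᶜ) = closure (closure (f ⁻¹' interior F.1))ᶜ
  rw [closure_preimage_eq hf hs F.isClosed.isOpen_compl, closure_compl, Set.preimage_compl,
    interior_compl]

theorem comap_sSup (hs : IsSkeletal f) (S : Set (RC Y)) :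
    comap f hf (sSup S) = sSup (comap f hf '' S) := by
  rw [sSup_eq_ofOpen, comap_ofOpen hf hs]
  refine Subtype.ext (subset_antisymm ?_ ?_)
  · refine closure_mono ?_
    rw [Set.preimage_iUnion₂]
    refine Set.iUnion₂_subset fun F hF => subset_closure.trans ?_
    exact Set.subset_biUnion_of_mem (u := fun G : RC X => G.1)
      (Set.mem_image_of_mem (comap f hf) hF)
  · refine closure_minimal (Set.iUnion₂_subset ?_) isClosed_closure
    rintro _ ⟨F, hF, rfl⟩
    exact closure_mono (Set.preimage_mono
      (Set.subset_biUnion_of_mem (u := fun F : RC Y => interior F.1) hF))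

theorem comap_sInf (hs : IsSkeletal f) (S : Set (RC Y)) :
    comap f hf (sInf S) = sInf (comap f hf '' S) := by
  rw [← compl_inj_iff, ← comap_compl hf hs, compl_sInf', compl_sInf', comap_sSup hf hs,
    Set.image_image, Set.image_image]
  simp_rw [comap_compl hf hs]

/-- `comap` along a continuous skeletal map, as a complete Boolean homomorphism. -/
def comapHom (hs : IsSkeletal f) : CompleteLatticeHom (RC Y) (RC X) where
  toFun := comap f hf
  map_sInf' := comap_sInf hf hs
  map_sSup' := comap_sSup hf hs

theorem leftAdj_comapHom_isCompact [T2Space Y] [LocallyCompactSpace Y] (hs : IsSkeletal f)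
    {K : RC X} (hK : IsCompact K.1) : IsCompact (leftAdj (comapHom hf hs) K).1 := by
  -- `f(K)` is compact, so it lies inside the interior of a compact `H`; then `K ≤ comap H`, and the
  -- adjunction bounds the left adjoint by `H`.
  obtain ⟨H, hH, hKH, -⟩ := exists_isCompact_between (hK.image hf) isOpen_univ
    (Set.subset_univ _)
  refine hH.of_isClosed_subset (isClosed _) ?_
  refine le_iff.1 (((gc_leftAdj (comapHom hf hs)) K H).2 ?_)
  exact (Set.image_subset_iff.1 hKH).trans subset_closure

end Comap

end RC

/-- The complete local contact algebra of regular closed sets. -/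
def regularClosed (X : SkeLC.{u}) : DSkeLC.{u} where
  carrier := RC X.carrier
  contact := RC.Contact
  bounded := RC.compactIdeal X.carrier
  isLocalContact := RC.isLocalContact

/-- The contravariant functor of regular closed sets. -/
def regularClosedFunctor : SkeLC.{u}ᵒᵖ ⥤ DSkeLC.{u} where
  obj X := regularClosed X.unop
  map f :=
    { hom := RC.comapHom f.unop.continuous_fn f.unop.skeletal_fn
      contact_of_contact := fun F G h => by
        obtain ⟨x, hF, hG⟩ := h
        exact ⟨_, RC.comap_subset f.unop.continuous_fn F hF,
          RC.comap_subset f.unop.continuous_fn G hG⟩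
      leftAdj_bounded := fun _ hK => RC.leftAdj_comapHom_isCompact _ _ hK }
  map_id X := DSkeLC.Mor.ext' (DFunLike.ext _ _ fun F => RC.ofOpen_interior F)
  map_comp f g := DSkeLC.Mor.ext' (DFunLike.ext _ _ fun F =>
    (RC.comap_ofOpen g.unop.continuous_fn g.unop.skeletal_fn
      (isOpen_interior.preimage f.unop.continuous_fn)).symm)

/-! ### Contact relations, ultrafilters and clusters -/

namespace IsContact

variable {B : Type u} [BooleanAlgebra B] {C : B → B → Prop}

theorem sup_left (h : IsContact C) (a b c : B) : C (a ⊔ b) c ↔ C a c ∨ C b c := by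
  constructor
  · intro hc
    exact ((h.sup_right _ _ _).1 (h.symm _ _ hc)).imp (h.symm _ _) (h.symm _ _)
  · intro hc
    exact h.symm _ _ ((h.sup_right _ _ _).2 (hc.imp (h.symm _ _) (h.symm _ _)))

theorem mono_right (h : IsContact C) {a b c : B} (hab : C a b) (hbc : b ≤ c) : C a c := by
  rw [← sup_eq_right.2 hbc]
  exact (h.sup_right _ _ _).2 (Or.inl hab)

theorem mono_left (h : IsContact C) {a b c : B} (hac : C a c) (hab : a ≤ b) : C b c :=
  h.symm _ _ (h.mono_right (h.symm _ _ hac) hab)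

theorem of_inf_ne_bot (h : IsContact C) {a b : B} (hab : a ⊓ b ≠ ⊥) : C a b :=
  h.mono_left (h.mono_right (h.refl_of_ne_bot _ hab) inf_le_right) inf_le_left

end IsContact

/-- Any two elements that are not in contact can be separated. -/
def Separating {B : Type u} [BooleanAlgebra B] (C : B → B → Prop) : Prop :=
  ∀ a d : B, ¬ C a d → ∃ b : B, ¬ C a bᶜ ∧ ¬ C b d

namespace IsBoolUltrafilter

variable {B : Type u} [BooleanAlgebra B] {v : Set B}

theorem inf_ne_bot (hv : IsBoolUltrafilter v) {a b : B} (ha : a ∈ v) (hb : b ∈ v) :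
    a ⊓ b ≠ ⊥ :=
  fun h => hv.bot_notMem (h ▸ hv.inf_mem a b ha hb)

theorem subset_clusterOf {C : B → B → Prop} (hC : IsContact C) (hv : IsBoolUltrafilter v) :
    v ⊆ clusterOf C v :=
  fun _ ha _ hb => hC.of_inf_ne_bot (hv.inf_ne_bot ha hb)

theorem isCluster_clusterOf {C : B → B → Prop} (hC : IsContact C) (hs : Separating C)
    (hv : IsBoolUltrafilter v) : IsCluster C (clusterOf C v) where
  nonempty := ⟨⊤, hv.subset_clusterOf hC hv.top_mem⟩
  contact a ha b hb := by
    by_contra hab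
    obtain ⟨c, hac, hcb⟩ := hs a b hab
    rcases hv.mem_or_compl_mem c with hc | hc
    · exact hcb (hC.symm _ _ (hb c hc))
    · exact hac (ha _ hc)
  mem_or_mem a b hab := by
    by_contra! h
    simp only [clusterOf, Set.mem_ofPred_eq, not_forall] at h
    obtain ⟨⟨x, hx, hax⟩, y, hy, hby⟩ := h
    rcases (hC.sup_left _ _ _).1 (hab _ (hv.inf_mem x y hx hy)) with h | h
    · exact hax (hC.mono_right h inf_le_left)
    · exact hby (hC.mono_right h inf_le_right)
  mem_of_contact a ha b hb := ha b (hv.subset_clusterOf hC hb)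

theorem preimage {A : Type u} [BooleanAlgebra A] {F : Type*} [FunLike F A B]
    [BoundedLatticeHomClass F A B] (hv : IsBoolUltrafilter v) (φ : F) :
    IsBoolUltrafilter (φ ⁻¹' v) where
  top_mem := by simpa using hv.top_mem
  bot_notMem := by simpa using hv.bot_notMem
  mem_of_le a b ha hab := hv.mem_of_le _ _ ha (OrderHomClass.mono φ hab)
  inf_mem a b ha hb := by simpa using hv.inf_mem _ _ ha hb
  mem_or_compl_mem a := by simpa [map_compl'] using hv.mem_or_compl_mem (φ a)

/-- An ideal that does not contain `a` is disjoint from an ultrafilter containing `a`. -/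
theorem exists_mem_disjoint (I : Order.Ideal B) {a : B} (ha : a ∉ I) :
    ∃ v : Set B, IsBoolUltrafilter v ∧ a ∈ v ∧ ∀ b ∈ v, b ∉ I := by
  have hd : Disjoint (Order.PFilter.principal a : Set B) (I : Set B) := by
    rw [Set.disjoint_left]
    exact fun x hx hxI => ha (I.lower (Order.PFilter.mem_principal.1 hx) hxI)
  obtain ⟨J, hJ, hIJ, haJ⟩ := DistribLattice.prime_ideal_of_disjoint_filter_ideal hd
  have htop : ⊤ ∉ J := fun h => Set.disjoint_left.1 haJ
    (Order.PFilter.mem_principal.2 le_rfl) (J.lower le_top h)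
  -- The ultrafilter is the complement of a prime ideal containing `I`.
  refine ⟨(J : Set B)ᶜ, ⟨htop, fun h => h J.bot_mem, fun x y hx hxy hy => hx (J.lower hxy hy),
    fun x y hx hy hxy => (hJ.mem_or_mem hxy).elim hx hy, fun x => ?_⟩,
    Set.disjoint_left.1 haJ (Order.PFilter.mem_principal.2 le_rfl), fun b hb hbI => hb (hIJ hbI)⟩
  by_contra! h
  simp only [Set.mem_compl_iff, not_not] at h
  exact htop (by simpa using J.sup_mem h.1 h.2)

theorem exists_mem {a : B} (ha : a ≠ ⊥) : ∃ v : Set B, IsBoolUltrafilter v ∧ a ∈ v := by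
  obtain ⟨v, hv, hav, -⟩ := exists_mem_disjoint (⊥ : Order.Ideal B) (a := a)
    fun h => ha (le_bot_iff.1 h)
  exact ⟨v, hv, hav⟩

end IsBoolUltrafilter

namespace IsCluster

variable {B : Type u} [BooleanAlgebra B] {C : B → B → Prop} {σ τ : Set B}

theorem mem_of_le (hC : IsContact C) (hσ : IsCluster C σ) {a b : B} (ha : a ∈ σ)
    (hab : a ≤ b) : b ∈ σ :=
  hσ.mem_of_contact b fun c hc => hC.mono_left (hσ.contact a ha c hc) hab

theorem top_mem (hC : IsContact C) (hσ : IsCluster C σ) : ⊤ ∈ σ :=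
  hσ.nonempty.elim fun _ ha => hσ.mem_of_le hC ha le_top

theorem bot_notMem (hC : IsContact C) (hσ : IsCluster C σ) : ⊥ ∉ σ :=
  fun h => (hC.ne_bot _ _ (hσ.contact _ h _ h)).1 rfl

theorem mem_or_compl_mem (hC : IsContact C) (hσ : IsCluster C σ) (a : B) :
    a ∈ σ ∨ aᶜ ∈ σ :=
  hσ.mem_or_mem a aᶜ (by rw [sup_compl_eq_top]; exact hσ.top_mem hC)

/-- Every element of `τ` is in contact with all of `τ`, hence with all of `σ`, and so belongs to
`σ`. -/
theorem eq_of_subset (hσ : IsCluster C σ) (hτ : IsCluster C τ) (h : σ ⊆ τ) : σ = τ :=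
  h.antisymm fun a ha => hσ.mem_of_contact a fun b hb => hτ.contact a ha b (h hb)

theorem eq_clusterOf (hC : IsContact C) (hs : Separating C) (hσ : IsCluster C σ) {v : Set B}
    (hv : IsBoolUltrafilter v) (h : v ⊆ σ) : σ = clusterOf C v :=
  hσ.eq_of_subset (hv.isCluster_clusterOf hC hs) fun a ha b hb => hσ.contact a ha b (h hb)

end IsCluster

namespace IsLocalContact

variable {B : Type u} [BooleanAlgebra B] {ρ : B → B → Prop} {I : Order.Ideal B}

theorem isContact_alexandroffExt (h : IsLocalContact ρ I) :
    IsContact (alexandroffExt ρ I) where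
  refl_of_ne_bot a ha := Or.inl (h.isContact.refl_of_ne_bot a ha)
  ne_bot a b hab := by
    rcases hab with hab | ⟨ha, hb⟩
    · exact h.isContact.ne_bot a b hab
    · exact ⟨fun e => ha (e ▸ I.bot_mem), fun e => hb (e ▸ I.bot_mem)⟩
  symm a b hab := hab.imp (h.isContact.symm a b) And.symm
  sup_right a b c := by
    simp only [alexandroffExt, h.isContact.sup_right, Order.Ideal.sup_mem_iff]
    tauto

/-- If `a` and `d` are not `C_ρ`-related, one of them is bounded, and (BC1) interpolates from that
side. When it is `d`, the separating element is the complement of the interpolant. -/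
theorem separating_alexandroffExt (h : IsLocalContact ρ I) :
    Separating (alexandroffExt ρ I) := by
  intro a d had
  simp only [alexandroffExt, not_or, not_and_or, not_not] at had ⊢
  obtain ⟨had, ha | hd⟩ := had
  · obtain ⟨b, hb, hab, hbd⟩ := h.exists_between a ha dᶜ (by rwa [NonTangential, compl_compl])
    rw [NonTangential, compl_compl] at hbd
    exact ⟨b, ⟨hab, Or.inl ha⟩, hbd, Or.inl hb⟩
  · obtain ⟨b, hb, hdb, hba⟩ := h.exists_between d hd aᶜ
      (by rw [NonTangential, compl_compl]; exact fun e => had (h.isContact.symm _ _ e))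
    rw [NonTangential, compl_compl] at hba
    refine ⟨bᶜ, ⟨?_, Or.inr ?_⟩, ?_, Or.inr hd⟩
    · rw [compl_compl]; exact fun e => hba (h.isContact.symm _ _ e)
    · rwa [compl_compl]
    · exact fun e => hdb (h.isContact.symm _ _ e)

theorem exists_nonTangential_of_mem (h : IsLocalContact ρ I) {a : B} (ha : a ∈ I) :
    ∃ b ∈ I, NonTangential (alexandroffExt ρ I) a b := by
  obtain ⟨b, hb, hab, -⟩ := h.exists_between a ha ⊤
    (by rw [NonTangential, compl_top]; exact fun e => (h.isContact.ne_bot _ _ e).2 rfl)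
  exact ⟨b, hb, fun e => e.elim hab fun e => e.1 ha⟩

end IsLocalContact

namespace DSkeLC

variable (A : DSkeLC.{u})

/-- The Alexandroff extension of the contact relation of `A`. -/
abbrev ext : A.carrier → A.carrier → Prop :=
  alexandroffExt A.contact A.bounded

theorem isContact_ext : IsContact A.ext :=
  A.isLocalContact.isContact_alexandroffExt

theorem separating_ext : Separating A.ext :=
  A.isLocalContact.separating_alexandroffExt

end DSkeLC

/-! ### The space of bounded clusters -/

namespace BClust

variable {A : DSkeLC.{u}}

theorem isCluster (σ : BClust A) : IsCluster A.ext σ.toSet :=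
  σ.1.2

theorem ext' {σ τ : BClust A} (h : σ.toSet = τ.toSet) : σ = τ :=
  Subtype.ext (Subtype.ext h)

/-- The bounded cluster given by an ultrafilter which contains a bounded element. -/
def ofUltrafilter {v : Set A.carrier} (hv : IsBoolUltrafilter v)
    (hb : ∃ a ∈ v, a ∈ A.bounded) : BClust A :=
  ⟨⟨clusterOf A.ext v, hv.isCluster_clusterOf A.isContact_ext A.separating_ext⟩,
    hb.imp fun _ h => ⟨hv.subset_clusterOf A.isContact_ext h.1, h.2⟩⟩

/-- The set of all bounded clusters containing `a`. -/
def basicSet (a : A.carrier) : Set (BClust A) :=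
  {σ | a ∈ σ.toSet}

theorem basicSet_mono {a b : A.carrier} (h : a ≤ b) : basicSet a ⊆ basicSet b :=
  fun σ ha => σ.isCluster.mem_of_le A.isContact_ext ha h

theorem basicSet_sup (a b : A.carrier) : basicSet (a ⊔ b) = basicSet a ∪ basicSet b :=
  subset_antisymm (fun σ h => σ.isCluster.mem_or_mem a b h)
    (Set.union_subset (basicSet_mono le_sup_left) (basicSet_mono le_sup_right))

theorem basicSet_bot : basicSet (⊥ : A.carrier) = ∅ :=
  Set.eq_empty_of_forall_notMem fun σ => σ.isCluster.bot_notMem A.isContact_ext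

theorem compl_basicSet_subset (a : A.carrier) : (basicSet a)ᶜ ⊆ basicSet aᶜ :=
  fun σ h => (σ.isCluster.mem_or_compl_mem A.isContact_ext a).resolve_left h

theorem topology_eq : instTopologicalSpaceBClust A =
    TopologicalSpace.generateFrom {U | ∃ a : A.carrier, U = (basicSet a)ᶜ} := by
  refine induced_generateFrom_eq.trans (congrArg _ (Set.ext fun U => ?_))
  constructor
  · rintro ⟨_, ⟨a, rfl⟩, rfl⟩
    exact ⟨a, rfl⟩
  · rintro ⟨a, rfl⟩
    exact ⟨_, ⟨a, rfl⟩, rfl⟩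

theorem isClosed_basicSet (a : A.carrier) : IsClosed (basicSet a) := by
  rw [← isOpen_compl_iff, topology_eq]
  exact TopologicalSpace.isOpen_generateFrom_of_mem ⟨a, rfl⟩

/-- The sets `{σ | a ∈ σ}` form a closed base. -/
theorem exists_notMem_of_isOpen {U : Set (BClust A)} (hU : IsOpen U) {σ : BClust A}
    (hσ : σ ∈ U) : ∃ a : A.carrier, σ ∉ basicSet a ∧ (basicSet a)ᶜ ⊆ U := by
  rw [topology_eq] at hU
  induction hU with
  | basic s hs =>
    obtain ⟨a, rfl⟩ := hs
    exact ⟨a, hσ, subset_rfl⟩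
  | univ => exact ⟨⊥, by rw [basicSet_bot]; exact Set.notMem_empty σ, Set.subset_univ _⟩
  | inter s t _ _ ihs iht =>
    obtain ⟨a, ha, has⟩ := ihs hσ.1
    obtain ⟨b, hb, hbt⟩ := iht hσ.2
    refine ⟨a ⊔ b, ?_, ?_⟩
    · rw [basicSet_sup]; exact fun h => h.elim ha hb
    · rw [basicSet_sup, Set.compl_union]
      exact Set.inter_subset_inter has hbt
  | sUnion S _ ih =>
    obtain ⟨s, hs, hσs⟩ := hσ
    obtain ⟨a, ha, has⟩ := ih s hs hσs
    exact ⟨a, ha, has.trans (Set.subset_sUnion_of_mem hs)⟩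

/-- (BC3) gives a nonzero bounded `b ≪ a`; any ultrafilter through `b` generates such a cluster. -/
theorem exists_compl_notMem {a : A.carrier} (ha : a ≠ ⊥) : ∃ σ : BClust A, aᶜ ∉ σ.toSet := by
  obtain ⟨b, hb, hb0, hba⟩ := A.isLocalContact.exists_nonTangential a ha
  obtain ⟨v, hv, hbv⟩ := IsBoolUltrafilter.exists_mem hb0
  refine ⟨ofUltrafilter hv ⟨b, hbv, hb⟩, fun h => ?_⟩
  rcases h b hbv with h | h
  · exact hba (A.isLocalContact.isContact.symm _ _ h)
  · exact h.2 hb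

theorem exists_mem_notMem {a b : A.carrier} (h : ¬ a ≤ b) :
    ∃ σ : BClust A, aᶜ ∉ σ.toSet ∧ b ∉ σ.toSet := by
  obtain ⟨σ, hσ⟩ := exists_compl_notMem (a := a ⊓ bᶜ) fun e =>
    h (sdiff_eq_bot_iff.1 (sdiff_eq.trans e))
  rw [compl_inf, compl_compl] at hσ
  exact ⟨σ, fun h => hσ (σ.isCluster.mem_of_le A.isContact_ext h le_sup_left),
    fun h => hσ (σ.isCluster.mem_of_le A.isContact_ext h le_sup_right)⟩

theorem basicSet_subset_iff {a b : A.carrier} : basicSet a ⊆ basicSet b ↔ a ≤ b := by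
  refine ⟨fun h => ?_, basicSet_mono⟩
  by_contra hab
  obtain ⟨σ, ha, hb⟩ := exists_mem_notMem hab
  exact hb (h ((σ.isCluster.mem_or_compl_mem A.isContact_ext a).resolve_right ha))

/-- A basic neighbourhood of `σ` omits some `b ∉ σ`, so `sSup S ≰ b` and already some `a ∈ S` has `a
≰ b`; a cluster omitting both `aᶜ` and `b` lies in that neighbourhood. A singleton `S` shows that
basic sets are regular closed. -/
theorem basicSet_sSup (S : Set A.carrier) :
    basicSet (sSup S) = closure (⋃ a ∈ S, (basicSet aᶜ)ᶜ) := by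
  refine subset_antisymm (fun σ hσ => mem_closure_iff.2 fun U hU hσU => ?_)
    (closure_minimal (Set.iUnion₂_subset fun a ha => ?_) (isClosed_basicSet _))
  · obtain ⟨b, hb, hbU⟩ := exists_notMem_of_isOpen hU hσU
    have hle : ¬ sSup S ≤ b := fun h => hb (basicSet_mono h hσ)
    rw [sSup_le_iff] at hle
    push Not at hle
    obtain ⟨a, ha, hab⟩ := hle
    obtain ⟨τ, hτa, hτb⟩ := exists_mem_notMem hab
    exact ⟨τ, hbU hτb, Set.mem_biUnion ha hτa⟩
  · refine (compl_basicSet_subset _).trans (basicSet_mono ?_)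
    rw [compl_compl]
    exact le_sSup ha

theorem closure_compl_basicSet_compl (a : A.carrier) :
    closure (basicSet aᶜ)ᶜ = basicSet a := by
  simpa using (basicSet_sSup {a}).symm

theorem closure_interior_basicSet (a : A.carrier) :
    closure (interior (basicSet a)) = basicSet a := by
  rw [← closure_compl_basicSet_compl a]
  exact RC.closure_isOpen_regular (isClosed_basicSet _).isOpen_compl

theorem exists_basicSet_eq {F : Set (BClust A)} (hF : closure (interior F) = F) :
    ∃ a : A.carrier, basicSet a = F := by
  refine ⟨sSup {a | (basicSet aᶜ)ᶜ ⊆ interior F}, ?_⟩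
  rw [basicSet_sSup]
  refine Eq.trans (congrArg closure ?_) hF
  refine subset_antisymm (Set.iUnion₂_subset fun a ha => ha) fun σ hσ => ?_
  obtain ⟨a, ha, haF⟩ := exists_notMem_of_isOpen isOpen_interior hσ
  refine Set.mem_biUnion (x := aᶜ) ?_ ?_
  · change (basicSet aᶜᶜ)ᶜ ⊆ _
    rwa [compl_compl]
  · rwa [compl_compl]

theorem exists_bounded_nhds (σ : BClust A) :
    ∃ b ∈ A.bounded, bᶜ ∉ σ.toSet := by
  obtain ⟨a, ha, haA⟩ := σ.2
  obtain ⟨b, hb, hab⟩ := A.isLocalContact.exists_nonTangential_of_mem haA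
  exact ⟨b, hb, fun h => hab (σ.isCluster.contact a ha _ h)⟩

theorem basicSet_inter_nonempty_iff {a b : A.carrier} :
    (basicSet a ∩ basicSet b).Nonempty ↔ A.contact a b := by
  have hA := A.isLocalContact
  constructor
  · rintro ⟨σ, ha, hb⟩
    obtain ⟨c, hc, hcσ⟩ := exists_bounded_nhds σ
    have hac : a ⊓ c ∈ σ.toSet := by
      refine (σ.isCluster.mem_or_mem (a ⊓ c) (a ⊓ cᶜ) ?_).resolve_right fun h =>
        hcσ (σ.isCluster.mem_of_le A.isContact_ext h inf_le_right)
      rwa [← inf_sup_left, sup_compl_eq_top, inf_top_eq]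
    refine hA.isContact.mono_left ((σ.isCluster.contact _ hac _ hb).resolve_right fun h => h.1 ?_)
      inf_le_left
    exact A.bounded.lower inf_le_right hc
  · intro hab
    -- By (BC2) `a` may be replaced by the bounded `c ⊓ a`. An ultrafilter through it that avoids
    -- the ideal of elements not in contact with `b` yields a bounded cluster containing `a` and
    -- `b`.
    obtain ⟨c, hc, hac⟩ := hA.exists_bounded b a (hA.isContact.symm _ _ hab)
    have hac' := hA.isContact.symm _ _ hac
    let I : Order.Ideal A.carrier :=
      { carrier := {x | ¬ A.ext x b}
        lower' := fun x y hyx hx hy => hx (A.isContact_ext.mono_left hy hyx)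
        nonempty' := ⟨⊥, fun h => (A.isContact_ext.ne_bot _ _ h).1 rfl⟩
        directed' := fun x hx y hy =>
          ⟨x ⊔ y, fun h => ((A.isContact_ext.sup_left _ _ _).1 h).elim hx hy,
            le_sup_left, le_sup_right⟩ }
    obtain ⟨v, hv, hav, hvI⟩ := IsBoolUltrafilter.exists_mem_disjoint I (a := c ⊓ a)
      fun h => h (Or.inl hac')
    refine ⟨ofUltrafilter hv ⟨_, hav, A.bounded.lower inf_le_left hc⟩, ?_, ?_⟩
    · exact hv.subset_clusterOf A.isContact_ext (hv.mem_of_le _ _ hav inf_le_right)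
    · exact fun x hx => A.isContact_ext.symm _ _ (not_not.1 (hvI x hx))

theorem isCompact_basicSet {a : A.carrier} (ha : a ∈ A.bounded) : IsCompact (basicSet a) := by
  rw [isCompact_iff_ultrafilter_le_nhds']
  intro 𝒰 h𝒰
  let I : Order.Ideal A.carrier :=
    { carrier := {x | basicSet x ∉ 𝒰}
      lower' := fun x y hyx hx hy => hx (Filter.mem_of_superset hy (basicSet_mono hyx))
      nonempty' := ⟨⊥, by
        change basicSet ⊥ ∉ 𝒰
        rw [basicSet_bot]
        exact Ultrafilter.empty_notMem⟩
      directed' := fun x hx y hy => ⟨x ⊔ y, by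
        change basicSet (x ⊔ y) ∉ 𝒰
        rw [basicSet_sup, Ultrafilter.union_mem_iff]
        -- The `x` with `basicSet x ∈ 𝒰` need not be closed under meets, so an ultrafilter `v` of
        -- the algebra is chosen among them; `𝒰` converges to `σ_v`.
        exact fun h => h.elim hx hy, le_sup_left, le_sup_right⟩ }
  obtain ⟨v, hv, hav, hvI⟩ := IsBoolUltrafilter.exists_mem_disjoint I (a := a) fun h => h h𝒰
  refine ⟨ofUltrafilter hv ⟨a, hav, ha⟩, hv.subset_clusterOf A.isContact_ext hav, ?_⟩
  intro U hU
  obtain ⟨V, hVU, hV, hσV⟩ := mem_nhds_iff.1 hU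
  obtain ⟨b, hb, hbV⟩ := exists_notMem_of_isOpen hV hσV
  have hb' : ∃ x ∈ v, ¬ A.ext b x := by
    by_contra! h
    exact hb h
  obtain ⟨x, hx, hbx⟩ := hb'
  refine Filter.mem_of_superset (not_not.1 (hvI x hx)) (fun τ hτ => hVU (hbV fun hτb => ?_))
  exact hbx (τ.isCluster.contact b hτb x hτ)

theorem isCompact_basicSet_iff {a : A.carrier} : IsCompact (basicSet a) ↔ a ∈ A.bounded := by
  refine ⟨fun h => ?_, isCompact_basicSet⟩
  suffices ∃ b ∈ A.bounded, basicSet a ⊆ basicSet b by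
    obtain ⟨b, hb, hab⟩ := this
    exact A.bounded.lower (basicSet_subset_iff.1 hab) hb
  -- Each point has a neighbourhood inside some `basicSet b` with `b` bounded, and bounded elements
  -- are closed under finite joins.
  refine h.induction_on (p := fun s => ∃ b ∈ A.bounded, s ⊆ basicSet b)
    ⟨⊥, A.bounded.bot_mem, Set.empty_subset _⟩ ?_ ?_ ?_
  · rintro s t hst ⟨b, hb, htb⟩
    exact ⟨b, hb, hst.trans htb⟩
  · rintro s t ⟨b, hb, hsb⟩ ⟨c, hc, htc⟩
    refine ⟨b ⊔ c, A.bounded.sup_mem hb hc, ?_⟩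
    rw [basicSet_sup]
    exact Set.union_subset_union hsb htc
  · intro σ _
    obtain ⟨b, hb, hbσ⟩ := exists_bounded_nhds σ
    refine ⟨(basicSet bᶜ)ᶜ,
      mem_nhdsWithin_of_mem_nhds ((isClosed_basicSet _).isOpen_compl.mem_nhds hbσ), b, hb, ?_⟩
    have := compl_basicSet_subset (bᶜ : A.carrier)
    rwa [compl_compl] at this

instance : T2Space (BClust A) where
  t2 σ τ hne := by
    have : ∃ a ∈ σ.toSet, ∃ b ∈ τ.toSet, ¬ A.ext a b := by
      by_contra! h
      refine hne (ext' (σ.isCluster.eq_of_subset τ.isCluster fun a ha => ?_))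
      exact τ.isCluster.mem_of_contact a (h a ha)
    obtain ⟨a, ha, b, hb, hab⟩ := this
    obtain ⟨c, hac, hcb⟩ := A.separating_ext a b hab
    refine ⟨(basicSet cᶜ)ᶜ, (basicSet c)ᶜ, (isClosed_basicSet _).isOpen_compl,
      (isClosed_basicSet _).isOpen_compl, fun h => hac (σ.isCluster.contact a ha _ h),
      fun h => hcb (τ.isCluster.contact _ h b hb), ?_⟩
    rw [Set.disjoint_left]
    exact fun x hx hx' => hx (compl_basicSet_subset c hx')

instance : WeaklyLocallyCompactSpace (BClust A) where
  exists_compact_mem_nhds σ := by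
    obtain ⟨b, hb, hbσ⟩ := exists_bounded_nhds σ
    refine ⟨basicSet b, isCompact_basicSet hb,
      Filter.mem_of_superset ((isClosed_basicSet bᶜ).isOpen_compl.mem_nhds hbσ) ?_⟩
    have := compl_basicSet_subset (bᶜ : A.carrier)
    rwa [compl_compl] at this

/-- The Boolean algebra of a complete local contact algebra is isomorphic to the regular closed
sets of its space of bounded clusters. -/
noncomputable def orderIso (A : DSkeLC.{u}) : A.carrier ≃o RC (BClust A) :=
  RelIso.ofSurjective
    (OrderEmbedding.ofMapLEIff
      (fun a => (⟨basicSet a, closure_interior_basicSet a⟩ : RC (BClust A)))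
      fun _ _ => basicSet_subset_iff)
    fun F => (exists_basicSet_eq F.2).imp fun _ h => Subtype.ext h

end BClust

/-! ### Recovering a skeletal map from a homomorphism -/

namespace RC

section PointMap

variable {X Y : Type u} [TopologicalSpace X] [TopologicalSpace Y]
  {φ : CompleteLatticeHom (RC Y) (RC X)}

theorem mem_or_mem_interior_map_compl (φ : CompleteLatticeHom (RC Y) (RC X)) (x : X)
    (G : RC Y) : x ∈ (φ G).1 ∨ x ∈ interior (φ Gᶜ).1 := by
  rw [mem_interior_iff, ← map_compl' φ, compl_compl]
  exact em _

/-- Condition (L1) says exactly that `φ` preserves `≪`. -/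
theorem map_subset_interior_map (hφ : ∀ F G : RC Y, Contact (φ F) (φ G) → Contact F G)
    {F G : RC Y} (h : F.1 ⊆ interior G.1) : (φ F).1 ⊆ interior (φ G).1 := by
  rw [← nonTangential_iff] at h ⊢
  intro hFG
  rw [← map_compl' φ] at hFG
  exact h (hφ _ _ hFG)

/-- The `G` with `x ∈ int φ(G)` are closed under finite meets. If no point lay in all of them,
compactness of `φ_Λ(K)` would give one such `G` disjoint from `φ_Λ(K)`, and then `x ∈ φ(φ_Λ(K) ∧ G)
= φ(0) = ∅`. -/
theorem exists_mem_of_mem_interior_map [T2Space X] [LocallyCompactSpace X]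
    (hφ : ∀ K : RC X, IsCompact K.1 → IsCompact (leftAdj φ K).1) (x : X) :
    ∃ y : Y, ∀ G : RC Y, x ∈ interior (φ G).1 → y ∈ G.1 := by
  obtain ⟨K, hK, hxK, -⟩ := exists_isCompact_mem isOpen_univ (Set.mem_univ x)
  have hxL : x ∈ interior (φ (leftAdj φ K)).1 :=
    interior_mono (le_iff.1 ((gc_leftAdj φ).le_u_l K)) hxK
  by_contra! hne
  suffices ∃ G : RC Y, x ∈ interior (φ G).1 ∧ (leftAdj φ K).1 ∩ G.1 = ∅ by
    obtain ⟨G, hxG, hG⟩ := this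
    have hx := interior_subset (interior_coe_inf _ _ ⟨hxL, hxG⟩)
    have hbot : leftAdj φ K ⊓ G = ⊥ := Subtype.ext (by
      rw [coe_inf, hG, interior_empty, closure_empty, coe_bot])
    rw [← map_inf φ, hbot, map_bot] at hx
    exact hx
  refine (hφ K hK).induction_on
    (p := fun s => ∃ G : RC Y, x ∈ interior (φ G).1 ∧ s ∩ G.1 = ∅) ?_ ?_ ?_ ?_
  · exact ⟨⊤, by simp [coe_top], Set.empty_inter _⟩
  · rintro s t hst ⟨G, hxG, htG⟩
    exact ⟨G, hxG, Set.subset_eq_empty (Set.inter_subset_inter_left _ hst) htG⟩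
  · rintro s t ⟨G, hxG, hsG⟩ ⟨H, hxH, htH⟩
    refine ⟨G ⊓ H, by rw [map_inf]; exact interior_coe_inf _ _ ⟨hxG, hxH⟩, ?_⟩
    rw [Set.union_inter_distrib_right]
    refine Set.union_empty_iff.2 ⟨Set.subset_eq_empty (Set.inter_subset_inter_right _ ?_) hsG,
      Set.subset_eq_empty (Set.inter_subset_inter_right _ ?_) htH⟩
    · exact le_iff.1 inf_le_left
    · exact le_iff.1 inf_le_right
  · intro y _
    obtain ⟨G, hxG, hyG⟩ := hne y
    exact ⟨G.1ᶜ, mem_nhdsWithin_of_mem_nhds (G.isClosed.isOpen_compl.mem_nhds hyG), G, hxG,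
      Set.compl_inter_self _⟩

variable {f : X → Y}

theorem preimage_interior_subset_map
    (hf : ∀ (x : X) (G : RC Y), x ∈ interior (φ G).1 → f x ∈ G.1) (G : RC Y) :
    f ⁻¹' interior G.1 ⊆ (φ G).1 := fun x hx =>
  (mem_or_mem_interior_map_compl φ x G).resolve_right fun h => mem_interior_iff.1 hx (hf x _ h)

variable [T2Space Y] [LocallyCompactSpace Y]

theorem continuous_of_mem_interior_map
    (hφ : ∀ F G : RC Y, Contact (φ F) (φ G) → Contact F G)
    (hf : ∀ (x : X) (G : RC Y), x ∈ interior (φ G).1 → f x ∈ G.1) : Continuous f := by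
  rw [continuous_iff_continuousAt]
  intro x U hU
  obtain ⟨V, hVU, hV, hxV⟩ := mem_nhds_iff.1 hU
  obtain ⟨H, -, hxH, hHV⟩ := exists_isCompact_mem hV hxV
  -- Two nested sets are needed: `f x ∈ int F` only gives `x ∈ φ(F)`, and `F ≪ H` moves `x` into the
  -- open set `int φ(H)`, which `f` maps into `H`.
  obtain ⟨F, -, hxF, hFH⟩ := exists_isCompact_mem isOpen_interior hxH
  have hx := map_subset_interior_map hφ hFH (preimage_interior_subset_map hf F hxF)
  rw [Filter.mem_map]
  exact Filter.mem_of_superset (isOpen_interior.mem_nhds hx)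
    fun z hz => hVU (hHV (hf z H hz))

/-- `cl V` is the join of the regular closed `F ⊆ V`. Since `φ` preserves joins, `φ(cl V)` is the
closure of the union of the sets `int φ(F)`, and `f` maps each of these into `F ⊆ V`. -/
theorem map_ofOpen_subset
    (hf : ∀ (x : X) (G : RC Y), x ∈ interior (φ G).1 → f x ∈ G.1) {V : Set Y}
    (hV : IsOpen V) : (φ (ofOpen V hV)).1 ⊆ closure (f ⁻¹' V) := by
  have hsup : ofOpen V hV = sSup {F : RC Y | F.1 ⊆ V} := by
    refine Subtype.ext (congrArg closure (subset_antisymm (fun y hy => ?_)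
      (Set.iUnion₂_subset fun F hF => hF)))
    obtain ⟨F, -, hyF, hFV⟩ := exists_isCompact_mem hV hy
    exact Set.mem_biUnion (t := fun F : RC Y => F.1) hFV (interior_subset hyF)
  rw [hsup, map_sSup, sSup_eq_ofOpen]
  refine closure_mono (Set.iUnion₂_subset ?_)
  rintro _ ⟨F, hF, rfl⟩ x hx
  exact hF (hf x F hx)

theorem isSkeletal_of_mem_interior_map
    (hf : ∀ (x : X) (G : RC Y), x ∈ interior (φ G).1 → f x ∈ G.1) : IsSkeletal f := by
  intro V hV x hx
  refine map_ofOpen_subset hf hV ((mem_or_mem_interior_map_compl φ x _).resolve_right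
    fun h => ?_)
  -- The complement of `cl V` in the algebra is the closure of the open set `(cl V)ᶜ`, so the same
  -- inclusion applies to it.
  have h' := map_ofOpen_subset hf isClosed_closure.isOpen_compl (interior_subset h)
  rw [Set.preimage_compl, closure_compl] at h'
  exact h' hx

theorem map_eq_closure_preimage_interior
    (hf : ∀ (x : X) (G : RC Y), x ∈ interior (φ G).1 → f x ∈ G.1) (G : RC Y) :
    (φ G).1 = closure (f ⁻¹' interior G.1) := by
  refine subset_antisymm ?_
    (closure_minimal (preimage_interior_subset_map hf G) (φ G).isClosed)
  have h := map_ofOpen_subset hf (isOpen_interior (s := G.1))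
  rwa [ofOpen_interior] at h

end PointMap

end RC

theorem SkeLC.Mor.ext' {X Y : SkeLC.{u}} {f g : SkeLC.Mor X Y} (h : f.fn = g.fn) : f = g := by
  cases f; cases g; cases h; rfl

instance : regularClosedFunctor.{u}.Full where
  map_surjective {X Y} φ := by
    choose f hf using RC.exists_mem_of_mem_interior_map (φ := φ.hom) φ.leftAdj_bounded
    let g : Y.unop ⟶ X.unop :=
      ⟨f, RC.continuous_of_mem_interior_map φ.contact_of_contact hf,
        RC.isSkeletal_of_mem_interior_map hf⟩
    exact ⟨g.op, DSkeLC.Mor.ext' (DFunLike.ext _ _ fun G =>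
      Subtype.ext (RC.map_eq_closure_preimage_interior hf G).symm)⟩

theorem map_mem_of_mem_map {X Y : SkeLC.{u}ᵒᵖ} (f : Y ⟶ X) {x : X.unop.carrier}
    {F : RC Y.unop.carrier}
    (h : x ∈ ((regularClosedFunctor.map f).hom F : RC X.unop.carrier).1) :
    f.unop.fn x ∈ F.1 :=
  RC.comap_subset f.unop.continuous_fn F h

theorem mem_map_of_map_mem_interior {X Y : SkeLC.{u}ᵒᵖ} (f : Y ⟶ X) {x : X.unop.carrier}
    {F : RC Y.unop.carrier} (h : f.unop.fn x ∈ interior F.1) :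
    x ∈ ((regularClosedFunctor.map f).hom F : RC X.unop.carrier).1 :=
  subset_closure h

instance : regularClosedFunctor.{u}.Faithful where
  map_injective {X Y} f g h := by
    refine Quiver.Hom.unop_inj (SkeLC.Mor.ext' (funext fun x => ?_))
    by_contra hne
    obtain ⟨F, -, hxF, hF⟩ := RC.exists_isCompact_mem isOpen_compl_singleton hne
    have hx := mem_map_of_map_mem_interior f hxF
    rw [h] at hx
    exact hF (map_mem_of_mem_map g hx) rfl

/-! ### Essential surjectivity -/

namespace DSkeLC

/-- An order isomorphism respecting contact and boundedness is an isomorphism of complete local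
contact algebras. -/
def isoOfOrderIso {A B : DSkeLC.{u}} (e : A.carrier ≃o B.carrier)
    (hc : ∀ a b, B.contact (e a) (e b) ↔ A.contact a b)
    (hb : ∀ a, e a ∈ B.bounded ↔ a ∈ A.bounded) : A ≅ B where
  hom :=
    { hom := CompleteLatticeHom.OrderIso.toCompleteLatticeHom e
      contact_of_contact := fun a b => (hc a b).1
      leftAdj_bounded := fun b h => by
        have : leftAdj (CompleteLatticeHom.OrderIso.toCompleteLatticeHom e) b = e.symm b :=
          (gc_leftAdj _).l_unique e.symm.to_galoisConnection fun _ => rfl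
        rw [this, ← hb, e.apply_symm_apply]
        exact h }
  inv :=
    { hom := CompleteLatticeHom.OrderIso.toCompleteLatticeHom e.symm
      contact_of_contact := fun a b h => by
        have := (hc _ _).2 h
        simpa using this
      leftAdj_bounded := fun a h => by
        have : leftAdj (CompleteLatticeHom.OrderIso.toCompleteLatticeHom e.symm) a = e a :=
          (gc_leftAdj _).l_unique e.to_galoisConnection fun _ => rfl
        rw [this, hb]
        exact h }
  hom_inv_id := Mor.ext' (DFunLike.ext _ _ e.symm_apply_apply)
  inv_hom_id := Mor.ext' (DFunLike.ext _ _ e.apply_symm_apply)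

/-- The locally compact Hausdorff space of bounded clusters. -/
def space (A : DSkeLC.{u}) : SkeLC.{u} where
  carrier := BClust A

/-- A complete local contact algebra is isomorphic to the algebra of regular closed sets of its
space of bounded clusters. -/
noncomputable def regularClosedIso (A : DSkeLC.{u}) :
    regularClosedFunctor.obj (op A.space) ≅ A :=
  (isoOfOrderIso (B := regularClosed A.space) (BClust.orderIso A)
    (fun _ _ => BClust.basicSet_inter_nonempty_iff)
    (fun _ => BClust.isCompact_basicSet_iff)).symm

theorem mem_regularClosedIso_inv {A : DSkeLC.{u}} (a : A.carrier) (σ : BClust A) :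
    σ ∈ ((regularClosedIso A).inv.hom a : RC (BClust A)).1 ↔ a ∈ σ.toSet :=
  Iff.rfl

end DSkeLC

section InverseOfIso

universe v₁ v₂ u₁ u₂

variable {C : Type u₁} [Category.{v₁} C] {D : Type u₂} [Category.{v₂} D] (F : C ⥤ D) [F.Full]
  [F.Faithful] (g : D → C) (i : ∀ d, F.obj (g d) ≅ d)

/-- The inverse of a fully faithful functor, given preimages of all objects up to isomorphism. -/
noncomputable abbrev inverseOfIso : D ⥤ C where
  obj := g
  map {X Y} f := F.preimage ((i X).hom ≫ f ≫ (i Y).inv)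
  map_id X := F.map_injective (by simp)
  map_comp f h := F.map_injective (by simp)

/-- A fully faithful functor with given preimages of all objects up to isomorphism is an
equivalence. -/
noncomputable def equivalenceOfIso : C ≌ D where
  functor := F
  inverse := inverseOfIso F g i
  unitIso := NatIso.ofComponents
    (fun X => (F.preimageIso (i (F.obj X))).symm)
    (fun f => F.map_injective (by simp))
  counitIso := NatIso.ofComponents i (by simp)
  functor_unitIso_comp X := by simp

theorem inv_comp_map_inverseOfIso_map {X Y : D} (f : X ⟶ Y) :
    (i X).inv ≫ F.map ((inverseOfIso F g i).map f) = f ≫ (i Y).inv := by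
  simp

end InverseOfIso

/-! ### The duality and its explicit formulas -/

/-- The contravariant functor of bounded clusters. -/
noncomputable def clusterFunctor : DSkeLC.{u} ⥤ SkeLC.{u}ᵒᵖ :=
  inverseOfIso regularClosedFunctor (fun A => op A.space) DSkeLC.regularClosedIso

/-- The duality between locally compact Hausdorff spaces with continuous skeletal maps and complete
local contact algebras. -/
noncomputable def duality : SkeLC.{u}ᵒᵖ ≌ DSkeLC.{u} :=
  equivalenceOfIso regularClosedFunctor (fun A => op A.space) DSkeLC.regularClosedIso

/-- Naturality of `a ↦ {σ | a ∈ σ}`, combined with `cl f⁻¹(int F) ⊆ f⁻¹(F)`. This one inclusion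
suffices below, since a cluster containing an ultrafilter is determined by it. -/
theorem mem_toSet_clusterFunctor_map {A B : DSkeLC.{u}} (φ : A ⟶ B) (σ : BClust B)
    {a : A.carrier} (ha : φ.hom a ∈ σ.toSet) :
    a ∈ BClust.toSet ((clusterFunctor.map φ).unop.fn σ) := by
  have h := congrArg (fun ψ : DSkeLC.Mor A (regularClosed B.space) => ψ.hom a)
    (inv_comp_map_inverseOfIso_map regularClosedFunctor (fun A => op A.space)
      DSkeLC.regularClosedIso φ)
  refine map_mem_of_mem_map (clusterFunctor.map φ)
    (F := A.regularClosedIso.inv.hom a) ?_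
  exact (congrArg (fun F : RC (BClust B) => σ ∈ F.1) h).mpr ha

theorem clusterFunctor_map_toSet {A B : DSkeLC.{u}} (φ : A ⟶ B) (σ : BClust B)
    {v : Set B.carrier} (hv : IsBoolUltrafilter v) (hσ : σ.toSet = clusterOf B.ext v) :
    BClust.toSet ((clusterFunctor.map φ).unop.fn σ) = clusterOf A.ext (φ.hom ⁻¹' v) := by
  refine (BClust.isCluster _).eq_clusterOf A.isContact_ext A.separating_ext
    (hv.preimage φ.hom) fun a ha => ?_
  refine mem_toSet_clusterFunctor_map φ σ ?_
  rw [hσ]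
  exact hv.subset_clusterOf B.isContact_ext ha

theorem mem_toSet_preimage_iff (X : SkeLC.{u}) (x : X.carrier) (F : RC X.carrier) :
    F ∈ BClust.toSet ((regularClosedFunctor.preimageIso (X := op (regularClosed X).space)
      (Y := op X) (regularClosed X).regularClosedIso).hom.unop.fn x) ↔ x ∈ F.1 := by
  let i : regularClosedFunctor.obj (op (regularClosed X).space) ≅
    regularClosedFunctor.obj (op X) := (regularClosed X).regularClosedIso
  let j := regularClosedFunctor.preimageIso i
  constructor
  · intro h
    have hinv : (regularClosedFunctor.map j.inv).hom F = i.inv.hom F :=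
      congrArg (fun ψ : DSkeLC.Mor (regularClosed X)
        (regularClosed (regularClosed X).space) => ψ.hom F)
          (regularClosedFunctor.map_preimage i.inv)
    -- Each direction uses only `cl f⁻¹(int F) ⊆ f⁻¹(F)`: here for the inverse homeomorphism, in the
    -- converse for the map itself.
    have hx : j.inv.unop.fn (j.hom.unop.fn x) ∈ F.1 :=
      map_mem_of_mem_map j.inv ((congrArg
        (fun G : RC (BClust (regularClosed X)) => j.hom.unop.fn x ∈ G.1) hinv).mpr h)
    have hid : j.inv.unop.fn (j.hom.unop.fn x) = x :=
      congrArg (fun f : SkeLC.Mor X X => f.fn x) (congrArg Quiver.Hom.unop j.inv_hom_id)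
    rwa [hid] at hx
  · intro hx
    have hcomp : i.inv ≫ regularClosedFunctor.map j.hom = 𝟙 _ :=
      (congrArg (i.inv ≫ ·) (regularClosedFunctor.map_preimage i.hom)).trans i.inv_hom_id
    have hF : (regularClosedFunctor.map j.hom).hom (i.inv.hom F) = F :=
      congrArg (fun ψ : DSkeLC.Mor (regularClosed X) (regularClosed X) => ψ.hom F) hcomp
    exact map_mem_of_mem_map j.hom (F := i.inv.hom F)
      ((congrArg (fun G : RC X.carrier => x ∈ G.1) hF).mpr hx)

theorem mem_toSet_duality_unitIso_inv (X : SkeLC.{u}) (x : X.carrier) (F : RC X.carrier) :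
    F ∈ BClust.toSet ((duality.unitIso.inv.app (op X)).unop.fn x) ↔ x ∈ F.1 :=
  mem_toSet_preimage_iff X x F

end SkeletalDuality

open SkeletalDuality
theorem theorem2p10 :
    ∃ e : SkeLC.{u}ᵒᵖ ≌ DSkeLC.{u},
      -- The two functors are, up to isomorphisms `θ` and `κ`, regular closed sets and
      -- bounded clusters.
      ∃ θ : ∀ X : SkeLC.{u}, (e.functor.obj (op X)).carrier ≃o RC X.carrier,
      ∃ κ : ∀ A : DSkeLC.{u}, (e.inverse.obj A).unop.carrier ≃ₜ BClust A,
        -- `θ X` is an isomorphism onto `RC X` with its standard contact relation and the ideal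
        -- of compact regular closed sets.
        (∀ (X : SkeLC.{u}) (a b : (e.functor.obj (op X)).carrier),
          (e.functor.obj (op X)).contact a b ↔ ((θ X a).1 ∩ (θ X b).1).Nonempty) ∧
        (∀ (X : SkeLC.{u}) (a : (e.functor.obj (op X)).carrier),
          a ∈ (e.functor.obj (op X)).bounded ↔ IsCompact (θ X a).1) ∧
        -- A map `f` is sent to `F ↦ cl (f⁻¹ (int F))`.
        (∀ (X Y : SkeLC.{u}) (f : X ⟶ Y) (a : (e.functor.obj (op Y)).carrier),
          (θ X ((e.functor.map f.op).hom a)).1 = closure (f.fn ⁻¹' interior (θ Y a).1)) ∧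
        -- A homomorphism `φ` is sent to `σ_v ↦ σ_{φ⁻¹ v}`, for `v` an ultrafilter.
        (∀ (A B : DSkeLC.{u}) (φ : A ⟶ B) (p : (e.inverse.obj B).unop.carrier)
            (v : Set B.carrier), IsBoolUltrafilter v →
          (κ B p).toSet = clusterOf (alexandroffExt B.contact B.bounded) v →
          (κ A ((e.inverse.map φ).unop.fn p)).toSet =
            clusterOf (alexandroffExt A.contact A.bounded) (φ.hom ⁻¹' v)) ∧
        -- The natural isomorphisms of the equivalence are `x ↦ {F | x ∈ F}` and
        -- `a ↦ {σ | a ∈ σ}`.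
        (∀ (X : SkeLC.{u}) (x : X.carrier) (a : (e.functor.obj (op X)).carrier),
          a ∈ (κ (e.functor.obj (op X)) ((e.unitIso.inv.app (op X)).unop.fn x)).toSet ↔
            x ∈ (θ X a).1) ∧
        (∀ (A : DSkeLC.{u}) (a : A.carrier) (p : (e.inverse.obj A).unop.carrier),
          p ∈ (θ (e.inverse.obj A).unop ((e.counitIso.inv.app A).hom a)).1 ↔
            a ∈ (κ A p).toSet) :=
  -- On objects both functors are the stated constructions by definition, so `θ` and `κ` are
  -- identities.
  ⟨duality, fun _ => OrderIso.refl _, fun _ => Homeomorph.refl _, fun _ _ _ => Iff.rfl,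
    fun _ _ => Iff.rfl, fun _ _ _ _ => rfl,
    fun _ _ φ σ _ hv hσ => clusterFunctor_map_toSet φ σ hv hσ,
    mem_toSet_duality_unitIso_inv, fun _ a σ => DSkeLC.mem_regularClosedIso_inv a σ⟩
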